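/- Let $\mathbf{Loc}=\mathbf{Frm}^{\mathrm{op}}$ be the category of locales, the opposite of the category of frames and frame homomorphisms. Let $\mathbf{cCstar}$ be the category of unital commutative (complex) C*-algebras, including the zero algebra, and unital $*$-homomorphisms, and let $\mathbf{Bool}$ be the category of Boolean algebras and their homomorphisms. Let $\mathrm{Spec}\colon \mathbf{cCstar}^{\mathrm{op}}\to\mathbf{Loc}$ be the Gelfand spectrum functor: it sends $A$ to the locale given by the frame of open subsets of the character space of $A$ (unital characters $A\to\mathbb{C}$ with the weak-$*$ topology), and sends a unital $*$-homomorphism $f\colon A\to B$ to the locale morphism induced by the continuous map $\chi\mapsto\chi\circ f$. Let $\mathrm{Idl}\colon \mathbf{Bool}^{\mathrm{op}}\to\mathbf{Loc}$ be the Stone spectrum functor: it sends $B$ to the locale given by the frame of ideals of $B$ ordered by inclusion, and sends a homomorphism $f\colon B\to B'$ to the locale morphism given by the frame homomorphism $I\mapsto\{y\in B' : y\le f(x)\text{ for some }x\in I\}$. Then $\mathrm{Spec}$ and $\mathrm{Idl}$ preserve all limits, that is, they send every limit cone over a diagram of any size to a limit cone. -/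

import Mathlib

open CategoryTheory CategoryTheory.Limits Opposite

universe u w w'

/-- The category of unital commutative C*-algebras over `ℂ`, with unital `*`-homomorphisms.
The zero algebra is an object. -/
structure CommCStarAlg where
  of ::
  carrier : Type u
  [str : CommCStarAlgebra carrier]

namespace CommCStarAlg

attribute [instance] CommCStarAlg.str

instance : CoeSort CommCStarAlg.{u} (Type u) := ⟨CommCStarAlg.carrier⟩

/-- Morphisms of commutative C*-algebras: unital `*`-homomorphisms. -/
@[ext]
structure Hom (A B : CommCStarAlg.{u}) where
  hom : A →⋆ₐ[ℂ] B

instance : Category CommCStarAlg.{u} where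
  Hom A B := Hom A B
  id A := ⟨StarAlgHom.id ℂ A⟩
  comp f g := ⟨g.hom.comp f.hom⟩

@[simp]
lemma hom_id (A : CommCStarAlg.{u}) : (𝟙 A : A ⟶ A).hom = StarAlgHom.id ℂ A := rfl

@[simp]
lemma hom_comp {A B C : CommCStarAlg.{u}} (f : A ⟶ B) (g : B ⟶ C) :
    (f ≫ g).hom = g.hom.comp f.hom := rfl

/-- The contravariant functor sending a commutative C*-algebra to its space of characters (with
the weak-* topology) and a `*`-homomorphism to precomposition with it. -/
noncomputable def characterSpaceFunctor : CommCStarAlg.{u}ᵒᵖ ⥤ TopCat.{u} where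
  obj A := TopCat.of (WeakDual.characterSpace ℂ A.unop)
  map f := TopCat.ofHom (WeakDual.CharacterSpace.compContinuousMap f.unop.hom)
  map_id A := by
    rw [unop_id, hom_id, WeakDual.CharacterSpace.compContinuousMap_id]; rfl
  map_comp f g := by
    rw [unop_comp, hom_comp, WeakDual.CharacterSpace.compContinuousMap_comp]; rfl

/-- The Gelfand spectrum functor `Spec`: a commutative C*-algebra is sent to the locale of open
sets of its character space. -/
noncomputable def gelfandSpec : CommCStarAlg.{u}ᵒᵖ ⥤ Locale.{u} :=
  characterSpaceFunctor ⋙ topToLocale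

end CommCStarAlg

namespace StoneSpectrum

section

variable {L M : Type u} [DistribLattice L] [BoundedOrder L] [DistribLattice M] [BoundedOrder M]

/-- Heyting implication of ideals of a distributive lattice. -/
def idealHimp (I J : Order.Ideal L) : Order.Ideal L where
  carrier := {x | ∀ i ∈ I, x ⊓ i ∈ J}
  lower' := fun _ _ hba ha i hi => J.lower (inf_le_inf_right i hba) (ha i hi)
  nonempty' := ⟨⊥, fun i _ => by simp⟩
  directed' := fun x hx y hy =>
    ⟨x ⊔ y, fun i hi => by
      rw [inf_sup_right]; exact Order.Ideal.sup_mem (hx i hi) (hy i hi),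
      le_sup_left, le_sup_right⟩

lemma le_idealHimp_iff (K I J : Order.Ideal L) : K ≤ idealHimp I J ↔ K ⊓ I ≤ J := by
  constructor
  · rintro h x ⟨hK, hI⟩
    have := h hK x hI
    rwa [inf_idem] at this
  · intro h x hx i hi
    exact h ⟨K.lower inf_le_left hx, I.lower inf_le_right hi⟩

/-- The ideals of a bounded distributive lattice, ordered by inclusion, form a frame. -/
instance idealFrame : Order.Frame (Order.Ideal L) where
  __ := (inferInstance : CompleteLattice (Order.Ideal L))
  himp := idealHimp
  le_himp_iff := le_idealHimp_iff
  compl I := idealHimp I ⊥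
  himp_bot _ := rfl

/-- The ideal generated by the image of an ideal under a lattice homomorphism. -/
def idealMap (f : BoundedLatticeHom L M) (I : Order.Ideal L) : Order.Ideal M where
  carrier := {y | ∃ x ∈ I, y ≤ f x}
  lower' := fun _ _ hba ⟨x, hx, h⟩ => ⟨x, hx, hba.trans h⟩
  nonempty' := ⟨⊥, ⊥, by simp, bot_le⟩
  directed' := fun y ⟨x, hx, h⟩ y' ⟨x', hx', h'⟩ =>
    ⟨y ⊔ y', ⟨x ⊔ x', Order.Ideal.sup_mem hx hx', by rw [map_sup]; exact sup_le_sup h h'⟩,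
      le_sup_left, le_sup_right⟩

lemma mem_idealMap {f : BoundedLatticeHom L M} {I : Order.Ideal L} {y : M} :
    y ∈ idealMap f I ↔ ∃ x ∈ I, y ≤ f x := Iff.rfl

/-- The preimage of an ideal under a lattice homomorphism. -/
def idealComap (f : BoundedLatticeHom L M) (J : Order.Ideal M) : Order.Ideal L where
  carrier := {x | f x ∈ J}
  lower' := fun _ _ hba ha => J.lower (OrderHomClass.mono f hba) ha
  nonempty' := ⟨⊥, by simp⟩
  directed' := fun x hx y hy =>
    ⟨x ⊔ y, by
      change f (x ⊔ y) ∈ J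
      rw [map_sup]; exact Order.Ideal.sup_mem hx hy, le_sup_left, le_sup_right⟩

lemma idealMap_gc (f : BoundedLatticeHom L M) : GaloisConnection (idealMap f) (idealComap f) := by
  intro I J
  constructor
  · intro h x hx
    exact h ⟨x, hx, le_rfl⟩
  · rintro h y ⟨x, hx, hy⟩
    exact J.lower hy (h hx)

/-- A lattice homomorphism induces a frame homomorphism between the frames of ideals. -/
def idealFrameHom (f : BoundedLatticeHom L M) :
    FrameHom (Order.Ideal L) (Order.Ideal M) where
  toFun := idealMap f
  map_inf' I J := by
    apply le_antisymm
    · exact le_inf ((idealMap_gc f).monotone_l inf_le_left)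
        ((idealMap_gc f).monotone_l inf_le_right)
    · rintro y ⟨⟨x, hx, h⟩, x', hx', h'⟩
      exact ⟨x ⊓ x', ⟨I.lower inf_le_left hx, J.lower inf_le_right hx'⟩, by
        rw [map_inf]; exact le_inf h h'⟩
  map_top' := top_le_iff.1 fun y _ => ⟨⊤, trivial, by simp⟩
  map_sSup' S := by
    rw [(idealMap_gc f).l_sSup, sSup_image]

lemma mem_idealFrameHom {f : BoundedLatticeHom L M} {I : Order.Ideal L} {y : M} :
    y ∈ idealFrameHom f I ↔ ∃ x ∈ I, y ≤ f x := Iff.rfl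

end

/-- The functor sending a Boolean algebra to its frame of ideals. -/
def idlFrm : BoolAlg.{u} ⥤ Frm.{u} where
  obj B := Frm.of (Order.Ideal B)
  map f := Frm.ofHom (idealFrameHom f.hom)
  map_id B := by
    refine Frm.ext fun (I : Order.Ideal B) => Order.Ideal.ext (Set.ext fun y => ?_)
    exact ⟨fun ⟨x, hx, h⟩ => I.lower h hx, fun h => ⟨y, h, le_rfl⟩⟩
  map_comp {A B C} f g := by
    refine Frm.ext fun (I : Order.Ideal A) => Order.Ideal.ext (Set.ext fun y => ?_)
    constructor
    · rintro ⟨x, hx, h⟩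
      exact ⟨f.hom x, ⟨x, hx, le_rfl⟩, h⟩
    · rintro ⟨z, ⟨x, hx, hz⟩, h⟩
      exact ⟨x, hx, h.trans (OrderHomClass.mono g.hom hz)⟩

/-- The Stone spectrum functor `Idl`: a Boolean algebra is sent to its frame of ideals,
regarded as a locale. -/
def stoneIdl : BoolAlg.{u}ᵒᵖ ⥤ Locale.{u} :=
  idlFrm.op

end StoneSpectrum

/-!
The ideal functor on Boolean algebras is a left adjoint: a frame homomorphism from the ideals of `B`
to a frame `L` is determined by its values on principal ideals, and these form an arbitrary
homomorphism from `B` to the Boolean algebra of complemented elements of `L`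
(`StoneSpectrum.idealHomEquiv`). Its opposite is therefore a right adjoint and preserves limits.

For the Gelfand spectrum, the difficulty is that a locale `L` mapping into the spectra of a diagram
may have no points, while a limit of algebras is controlled by characters, which are points. It is
resolved by replacing `L` with the space `P` of prime ideals of its frame, which has enough points.
Given a frame homomorphism `f` from the opens of a compact Hausdorff space `X` to `L`, each prime
ideal `p` gives the prime filter of the opens `U` with `f U ∉ p`, and this filter has a unique limit
in `X`. The resulting map `P → X` is continuous, since `X` is regular, and natural in `X`. Moreover
`f` is recovered as preimage along this map followed by the homomorphism from the opens of `P`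
(that is, the ideals of `L`) to `L` taking joins
(`LatticePrimeSpectrum.joinHom_preimage_limitPoint`).

A compatible family of locale maps from `L` to the spectra of a diagram therefore becomes a
compatible family of continuous maps from `P`. Characters are morphisms to the algebra of scalars,
so they lift pointwise to the spectrum `X` of the limit algebra, and uniquely. As `X` is compact and
the projections are jointly injective, `X` has the topology they induce. So the lifted map `P → X`
is continuous, and it gives the required frame homomorphism from the opens of `X` to `L`
(`existsUnique_frameHom_of_limitPoint_lift`). It is the only one because the
preimages of opens under the projections generate the opens of `X`. Nothing here depends on the size
of the diagram.
-/

/-! ### The prime spectrum of a frame -/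

/-- The prime ideals of a lattice `L`. When `L` is a frame, they are topologized by the basic open
sets of prime ideals that omit a given element, and the opens correspond to the ideals of `L`. -/
structure LatticePrimeSpectrum (L : Type u) [Lattice L] where
  /-- The underlying ideal. -/
  ideal : Order.Ideal L
  isPrime : ideal.IsPrime

namespace LatticePrimeSpectrum

/-- The basic open set of the prime ideals omitting `a`. -/
def basicOpen {L : Type u} [Lattice L] (a : L) : Set (LatticePrimeSpectrum L) :=
  {p | a ∉ p.ideal}

lemma basicOpen_inf {L : Type u} [Lattice L] (a b : L) :
    basicOpen (a ⊓ b) = basicOpen a ∩ basicOpen b := by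
  ext p
  constructor
  · exact fun h => ⟨fun ha => h (p.ideal.lower inf_le_left ha),
      fun hb => h (p.ideal.lower inf_le_right hb)⟩
  · exact fun h hab => (p.isPrime.mem_or_mem hab).elim h.1 h.2

/-- Prime ideals separate elements of a distributive lattice. -/
lemma le_of_basicOpen_subset {L : Type u} [DistribLattice L] {a b : L}
    (h : basicOpen a ⊆ basicOpen b) : a ≤ b := by
  by_contra hab
  have hd : Disjoint (Order.PFilter.principal a : Set L) (Order.Ideal.principal b : Set L) :=
    Set.disjoint_left.2 fun x hx hx' => hab (le_trans hx hx')
  obtain ⟨J, hJ, hbJ, haJ⟩ := DistribLattice.prime_ideal_of_disjoint_filter_ideal hd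
  exact h (a := ⟨J, hJ⟩) (Set.disjoint_left.1 haJ (le_refl a)) (hbJ (le_refl b))

variable {L : Type u} [Order.Frame L]

lemma top_notMem (p : LatticePrimeSpectrum L) : ⊤ ∉ p.ideal :=
  p.isPrime.toIsProper.top_notMem

instance : TopologicalSpace (LatticePrimeSpectrum L) where
  IsOpen W := ∀ p ∈ W, ∃ a, p ∈ basicOpen a ∧ basicOpen a ⊆ W
  isOpen_univ p _ := ⟨⊤, p.top_notMem, Set.subset_univ _⟩
  isOpen_inter W W' hW hW' p hp := by
    obtain ⟨a, hpa, haW⟩ := hW p hp.1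
    obtain ⟨b, hpb, hbW⟩ := hW' p hp.2
    refine ⟨a ⊓ b, ?_⟩
    rw [basicOpen_inf]
    exact ⟨⟨hpa, hpb⟩, Set.inter_subset_inter haW hbW⟩
  isOpen_sUnion S hS p := by
    rintro ⟨W, hW, hp⟩
    obtain ⟨a, hpa, haW⟩ := hS W hW p hp
    exact ⟨a, hpa, haW.trans (Set.subset_sUnion_of_mem hW)⟩

lemma isOpen_iff {W : Set (LatticePrimeSpectrum L)} :
    IsOpen W ↔ ∀ p ∈ W, ∃ a, p ∈ basicOpen a ∧ basicOpen a ⊆ W := Iff.rfl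

/-- The frame homomorphism that sends an open set `W` of prime ideals to the join of the elements
whose basic open set is contained in `W`. Under the identification of opens with ideals of `L`, it
sends an ideal to its join in `L`. -/
def joinHom : FrameHom (TopologicalSpace.Opens (LatticePrimeSpectrum L)) L where
  toFun W := sSup {a | basicOpen a ⊆ W}
  map_inf' W W' := by
    apply le_antisymm
    · refine sSup_le fun a ha => ?_
      exact le_inf (le_sSup (ha.trans Set.inter_subset_left))
        (le_sSup (ha.trans Set.inter_subset_right))
    · rw [sSup_inf_sSup]
      refine iSup₂_le fun x hx => le_sSup ?_
      rw [Set.mem_ofPred_eq, basicOpen_inf]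
      exact Set.inter_subset_inter hx.1 hx.2
  map_top' := top_le_iff.1 (le_sSup (Set.subset_univ _))
  map_sSup' S := by
    apply le_antisymm
    · refine sSup_le fun a ha => le_of_basicOpen_subset fun p hp hpm => ?_
      -- A prime ideal containing the join on the right contains every element over which it is
      -- taken, so it lies in none of the members of `S`.
      obtain ⟨W, hW, hpW⟩ := TopologicalSpace.Opens.mem_sSup.1 (ha hp)
      obtain ⟨b, hpb, hbW⟩ := isOpen_iff.1 W.isOpen p hpW
      have hb : b ≤ sSup {a | basicOpen a ⊆ (W : Set (LatticePrimeSpectrum L))} := le_sSup hbW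
      exact hpb (p.ideal.lower (hb.trans (le_sSup (Set.mem_image_of_mem
        (fun W : TopologicalSpace.Opens (LatticePrimeSpectrum L) =>
          sSup {a | basicOpen a ⊆ (W : Set (LatticePrimeSpectrum L))}) hW))) hpm)
    · refine sSup_le ?_
      rintro _ ⟨W, hW, rfl⟩
      exact sSup_le_sSup fun a ha => Set.Subset.trans ha (show W ≤ sSup S from le_sSup hW)

lemma joinHom_apply (W : TopologicalSpace.Opens (LatticePrimeSpectrum L)) :
    joinHom W = sSup {a | basicOpen a ⊆ W} := rfl

/-! ### Factoring a locale map into a compact Hausdorff space through the prime spectrum -/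

section Limit

open TopologicalSpace

variable {X : Type*} [TopologicalSpace X]

lemma map_mem_or_map_mem (f : FrameHom (Opens X) L) (p : LatticePrimeSpectrum L)
    {U V : Opens X} (h : Disjoint U V) : f U ∈ p.ideal ∨ f V ∈ p.ideal := by
  refine p.isPrime.mem_or_mem ?_
  rw [← map_inf, h.eq_bot, map_bot]
  exact p.ideal.bot_mem

variable [CompactSpace X]

lemma exists_forall_mem_notMem (f : FrameHom (Opens X) L) (p : LatticePrimeSpectrum L) :
    ∃ x : X, ∀ U : Opens X, x ∈ U → f U ∉ p.ideal := by
  by_contra! h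
  choose U hxU hU using h
  obtain ⟨t, ht⟩ := isCompact_univ.elim_finite_subcover (fun x => (U x : Set X))
    (fun x => (U x).isOpen) (fun x _ => Set.mem_iUnion.2 ⟨x, hxU x⟩)
  have htop : t.sup U = ⊤ := by
    refine top_le_iff.1 fun x _ => ?_
    obtain ⟨y, hy, hxy⟩ := Set.mem_iUnion₂.1 (ht (Set.mem_univ x))
    exact (Finset.le_sup (f := U) hy) hxy
  refine p.top_notMem ?_
  rw [← map_top f, ← htop, map_finset_sup]
  exact (Order.Ideal.finsetSup_mem_iff _).2 fun x _ => hU x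

/-- For a frame homomorphism `f` from the opens of a compact space and a prime ideal `p`, a limit of
the prime filter of the opens `U` with `f U ∉ p`. It is unique if the space is Hausdorff. -/
noncomputable def limitPoint (f : FrameHom (Opens X) L) (p : LatticePrimeSpectrum L) : X :=
  (exists_forall_mem_notMem f p).choose

lemma notMem_of_limitPoint_mem (f : FrameHom (Opens X) L) (p : LatticePrimeSpectrum L)
    {U : Opens X} (h : limitPoint f p ∈ U) : f U ∉ p.ideal :=
  (exists_forall_mem_notMem f p).choose_spec U h

lemma limitPoint_mem_of_closure_subset (f : FrameHom (Opens X) L) (p : LatticePrimeSpectrum L)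
    {U V : Opens X} (hVU : closure (V : Set X) ⊆ U) (hV : f V ∉ p.ideal) :
    limitPoint f p ∈ U := by
  by_contra h
  have hd : Disjoint V (⟨(closure (V : Set X))ᶜ, isClosed_closure.isOpen_compl⟩ : Opens X) := by
    rw [← Opens.coe_disjoint]
    exact Set.disjoint_compl_right_iff_subset.2 subset_closure
  exact (map_mem_or_map_mem f p hd).elim hV
    (notMem_of_limitPoint_mem f p fun hc => h (hVU hc))

variable [T2Space X]

lemma exists_closure_subset {U : Opens X} {x : X} (hx : x ∈ U) :
    ∃ V : Opens X, x ∈ V ∧ closure (V : Set X) ⊆ U := by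
  obtain ⟨t, ht, htc, htU⟩ := exists_mem_nhds_isClosed_subset (U.isOpen.mem_nhds hx)
  obtain ⟨V, hVt, hV, hxV⟩ := mem_nhds_iff.1 ht
  exact ⟨⟨V, hV⟩, hxV, (closure_minimal hVt htc).trans htU⟩

lemma eq_limitPoint (f : FrameHom (Opens X) L) (p : LatticePrimeSpectrum L) {x : X}
    (h : ∀ U : Opens X, x ∈ U → f U ∉ p.ideal) : limitPoint f p = x := by
  by_contra hne
  obtain ⟨U, V, hU, hV, hxU, hxV, hd⟩ := t2_separation hne
  have hd' : Disjoint (⟨U, hU⟩ : Opens X) ⟨V, hV⟩ := by rwa [← Opens.coe_disjoint]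
  exact (map_mem_or_map_mem f p hd').elim (notMem_of_limitPoint_mem f p hxU) (h _ hxV)

lemma continuous_limitPoint (f : FrameHom (Opens X) L) : Continuous (limitPoint f) := by
  refine continuous_def.2 fun U hU p hp => ?_
  obtain ⟨V, hpV, hVU⟩ := exists_closure_subset (U := ⟨U, hU⟩) hp
  exact ⟨f V, notMem_of_limitPoint_mem f p hpV,
    fun q hq => limitPoint_mem_of_closure_subset f q hVU hq⟩

/-- Passing to limit points is compatible with continuous maps of compact Hausdorff spaces. -/
lemma limitPoint_comp_comap {Y : Type*} [TopologicalSpace Y] [CompactSpace Y]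
    (f : FrameHom (Opens Y) L) (φ : C(Y, X)) (p : LatticePrimeSpectrum L) :
    limitPoint (f.comp (Opens.comap φ)) p = φ (limitPoint f p) :=
  eq_limitPoint _ p fun _ hU => notMem_of_limitPoint_mem f p hU

/-- A locale map into a compact Hausdorff space is recovered from the continuous map
`limitPoint f` it induces on the prime spectrum. -/
lemma joinHom_preimage_limitPoint (f : FrameHom (Opens X) L) (U : Opens X) :
    joinHom (Opens.comap ⟨limitPoint f, continuous_limitPoint f⟩ U) = f U := by
  rw [joinHom_apply]
  apply le_antisymm
  · exact sSup_le fun a ha => le_of_basicOpen_subset fun p hp =>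
      notMem_of_limitPoint_mem f p (ha hp)
  · have hU : U = sSup {V : Opens X | closure (V : Set X) ⊆ U} := by
      refine le_antisymm (fun x hx => ?_) (sSup_le fun V hV => subset_closure.trans hV)
      obtain ⟨V, hxV, hVU⟩ := exists_closure_subset hx
      exact Opens.mem_sSup.2 ⟨V, hVU, hxV⟩
    conv_lhs => rw [hU, map_sSup]
    refine sSup_le ?_
    rintro _ ⟨V, hV, rfl⟩
    exact le_sSup fun p hp => limitPoint_mem_of_closure_subset f p hV hp

end Limit

end LatticePrimeSpectrum

/-! ### Jointly injective families on a compact space -/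

section JointlyInjective

open TopologicalSpace Topology

variable {ι : Type*} {X : Type*} [tX : TopologicalSpace X] [CompactSpace X]
  {Y : ι → Type*} [tY : ∀ i, TopologicalSpace (Y i)] [∀ i, T2Space (Y i)]

lemma isInducing_pi_of_jointly_injective (π : ∀ i, C(X, Y i))
    (hπ : ∀ x x', (∀ i, π i x = π i x') → x = x') :
    IsInducing fun x i => π i x := by
  have hc : Continuous fun x i => π i x := continuous_pi fun i => (π i).continuous
  exact (hc.isClosedEmbedding fun x x' h => hπ x x' fun i => congrFun h i).isInducing

lemma continuous_of_jointly_injective {Z : Type*} [TopologicalSpace Z] (π : ∀ i, C(X, Y i))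
    (hπ : ∀ x x', (∀ i, π i x = π i x') → x = x') {F : Z → X}
    (hF : ∀ i, Continuous fun z => π i (F z)) : Continuous F :=
  (isInducing_pi_of_jointly_injective π hπ).continuous_iff.2 (continuous_pi hF)

/-- The preimages of opens under a jointly injective family generate the opens of a compact space,
so they determine the frame homomorphisms out of them. -/
lemma FrameHom.ext_of_jointly_injective {L : Type*} [Order.Frame L] (π : ∀ i, C(X, Y i))
    (hπ : ∀ x x', (∀ i, π i x = π i x') → x = x') {g g' : FrameHom (Opens X) L}
    (h : ∀ i, g.comp (Opens.comap (π i)) = g'.comp (Opens.comap (π i))) :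
    g = g' := by
  have ht : tX = ⨅ i, (tY i).induced (π i) := by
    refine (isInducing_pi_of_jointly_injective π hπ).eq_induced.trans ?_
    rw [Pi.topologicalSpace, induced_iInf]
    simp only [induced_compose]
    rfl
  rw [← generateFrom_iUnion_isOpen] at ht
  have key : ∀ s : Set X, GenerateOpen (⋃ i, {s | @IsOpen X ((tY i).induced (π i)) s}) s →
      ∃ U : Opens X, (U : Set X) = s ∧ g U = g' U := by
    intro s hs
    induction hs with
    | basic s hs =>
      obtain ⟨i, V, hV, rfl⟩ := Set.mem_iUnion.1 hs
      exact ⟨Opens.comap (π i) ⟨V, hV⟩, rfl, DFunLike.congr_fun (h i) ⟨V, hV⟩⟩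
    | univ => exact ⟨⊤, rfl, by rw [map_top, map_top]⟩
    | inter s t _ _ hs ht =>
      obtain ⟨U, rfl, hU⟩ := hs
      obtain ⟨V, rfl, hV⟩ := ht
      exact ⟨U ⊓ V, rfl, by rw [map_inf, map_inf, hU, hV]⟩
    | sUnion S _ hS =>
      refine ⟨sSup {U | (U : Set X) ∈ S ∧ g U = g' U}, ?_, ?_⟩
      · ext x
        rw [SetLike.mem_coe, Opens.mem_sSup]
        constructor
        · rintro ⟨U, hU, hx⟩
          exact ⟨U, hU.1, hx⟩
        · rintro ⟨s, hs, hx⟩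
          obtain ⟨U, rfl, hU⟩ := hS s hs
          exact ⟨U, ⟨hs, hU⟩, hx⟩
      · rw [map_sSup, map_sSup, Set.image_congr fun U hU => hU.2]
  refine FrameHom.ext fun U => ?_
  have hU : GenerateOpen (⋃ i, {s | @IsOpen X ((tY i).induced (π i)) s}) (U : Set X) :=
    ht.ge _ U.isOpen
  obtain ⟨U', hU', hg⟩ := key U hU
  rwa [SetLike.coe_injective hU'] at hg

open LatticePrimeSpectrum in
/-- A family of locale maps from `L` into compact Hausdorff spaces lifts uniquely along a jointly
injective family as soon as the induced maps on the prime spectrum lift pointwise. -/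
lemma existsUnique_frameHom_of_limitPoint_lift [∀ i, CompactSpace (Y i)] {L : Type*}
    [Order.Frame L] (π : ∀ i, C(X, Y i)) (hπ : ∀ x x', (∀ i, π i x = π i x') → x = x')
    (f : ∀ i, FrameHom (Opens (Y i)) L) {F : LatticePrimeSpectrum L → X}
    (hF : ∀ p i, π i (F p) = limitPoint (f i) p) :
    ∃! g : FrameHom (Opens X) L, ∀ i, g.comp (Opens.comap (π i)) = f i := by
  have hFc : Continuous F := continuous_of_jointly_injective π hπ
    fun i => (continuous_limitPoint (f i)).congr fun p => (hF p i).symm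
  have hfac : ∀ i, (joinHom.comp (Opens.comap ⟨F, hFc⟩)).comp (Opens.comap (π i)) = f i := by
    refine fun i => FrameHom.ext fun U => ?_
    rw [← joinHom_preimage_limitPoint (f i) U]
    refine congrArg joinHom (Opens.ext (Set.ext fun p => ?_))
    exact iff_of_eq (congrArg (· ∈ U) (hF p i))
  exact ⟨_, hfac, fun g' hg' => FrameHom.ext_of_jointly_injective π hπ
    fun i => (hg' i).trans (hfac i).symm⟩

end JointlyInjective

/-! ### Characters as morphisms -/

namespace CommCStarAlg

/-- The algebra of complex scalars, as the continuous functions on a point, which places it in an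
arbitrary universe. -/
noncomputable def scalars : CommCStarAlg.{u} := of C(PUnit.{u + 1}, ℂ)

/-- A character, as a morphism to the scalars. -/
noncomputable def ofCharacter {A : CommCStarAlg.{u}} (χ : WeakDual.characterSpace ℂ A) :
    A ⟶ scalars.{u} where
  hom := show A →⋆ₐ[ℂ] C(PUnit.{u + 1}, ℂ) from
    { toFun := fun a => ContinuousMap.const _ (χ a)
      map_one' := by ext; exact map_one χ
      map_mul' := fun a b => by ext; exact map_mul χ a b
      map_zero' := by ext; exact map_zero χ
      map_add' := fun a b => by ext; exact map_add χ a b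
      commutes' := fun z => by ext; exact AlgHomClass.commutes χ z
      map_star' := fun a => by ext; exact map_star χ a }

/-- The character underlying a morphism to the scalars. -/
noncomputable def toCharacter {A : CommCStarAlg.{u}} (f : A ⟶ scalars.{u}) :
    WeakDual.characterSpace ℂ A :=
  WeakDual.CharacterSpace.equivAlgHom.symm
    ((ContinuousMap.evalAlgHom ℂ ℂ PUnit.unit).comp f.hom.toAlgHom)

lemma toCharacter_ofCharacter {A : CommCStarAlg.{u}} (χ : WeakDual.characterSpace ℂ A) :
    toCharacter (ofCharacter χ) = χ :=
  WeakDual.CharacterSpace.ext fun _ => rfl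

lemma characterSpaceFunctor_map_toCharacter {A B : CommCStarAlg.{u}} (f : A ⟶ B)
    (g : B ⟶ scalars.{u}) :
    characterSpaceFunctor.map f.op (toCharacter g) = toCharacter (f ≫ g) :=
  WeakDual.CharacterSpace.ext fun _ => rfl

instance (A : CommCStarAlg.{u}ᵒᵖ) : CompactSpace (characterSpaceFunctor.obj A) :=
  inferInstanceAs (CompactSpace (WeakDual.characterSpace ℂ A.unop))

instance (A : CommCStarAlg.{u}ᵒᵖ) : T2Space (characterSpaceFunctor.obj A) :=
  inferInstanceAs (T2Space (WeakDual.characterSpace ℂ A.unop))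

section Limit

variable {J : Type w} [Category.{w'} J] {K : J ⥤ CommCStarAlg.{u}ᵒᵖ} {c : Cone K}

/-- The continuous map that a projection of a cone induces on character spaces. -/
noncomputable def characterProj (c : Cone K) (j : J) :
    C(characterSpaceFunctor.obj c.pt, characterSpaceFunctor.obj (K.obj j)) :=
  (characterSpaceFunctor.map (c.π.app j)).hom

/-- The points of the Gelfand spectrum of a limit are separated by the projections. -/
lemma character_ext_of_isLimit (hc : IsLimit c) (χ χ' : characterSpaceFunctor.obj c.pt)
    (h : ∀ j, characterProj c j χ = characterProj c j χ') : χ = χ' := by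
  have key : (ofCharacter χ).op = (ofCharacter χ').op := hc.hom_ext fun j =>
    congrArg (fun ψ => (ofCharacter ψ).op) (h j)
  rw [← toCharacter_ofCharacter χ, ← toCharacter_ofCharacter χ', Quiver.Hom.op_inj key]

/-- Compatible families of characters lift to the Gelfand spectrum of a limit. -/
lemma exists_character_of_isLimit (hc : IsLimit c)
    (χ : ∀ j, characterSpaceFunctor.obj (K.obj j))
    (h : ∀ {i j} (f : i ⟶ j), characterSpaceFunctor.map (K.map f) (χ i) = χ j) :
    ∃ ψ : characterSpaceFunctor.obj c.pt, ∀ j, characterProj c j ψ = χ j := by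
  let s : Cone K :=
    { pt := op scalars
      π :=
        { app := fun j => (ofCharacter (χ j)).op
          naturality := fun i j f => by
            rw [← h f]
            exact Category.id_comp _ } }
  refine ⟨toCharacter (hc.lift s).unop, fun j => ?_⟩
  refine (characterSpaceFunctor_map_toCharacter (c.π.app j).unop (hc.lift s).unop).trans ?_
  rw [← unop_comp, hc.fac s j]
  exact toCharacter_ofCharacter (χ j)

/-! ### Extending frame homomorphisms to the spectrum of a limit -/

open TopologicalSpace LatticePrimeSpectrum in
/-- Compatible frame homomorphisms out of the opens of the character spaces of a diagram extend
uniquely to the opens of the character space of its limit. -/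
lemma existsUnique_frameHom (hc : IsLimit c) {L : Type u} [Order.Frame L]
    (f : ∀ j, FrameHom (Opens (characterSpaceFunctor.obj (K.obj j))) L)
    (hf : ∀ {i j} (a : i ⟶ j),
      (f i).comp (Opens.comap (characterSpaceFunctor.map (K.map a)).hom) = f j) :
    ∃! g : FrameHom (Opens (characterSpaceFunctor.obj c.pt)) L,
      ∀ j, g.comp (Opens.comap (characterProj c j)) = f j := by
  -- Each prime ideal of `L` determines compatible characters, hence a character of the limit.
  have hex (p : LatticePrimeSpectrum L) : ∃ ψ : characterSpaceFunctor.obj c.pt,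
      ∀ j, characterProj c j ψ = limitPoint (f j) p :=
    exists_character_of_isLimit hc (fun j => limitPoint (f j) p) fun {i j} a => by
      rw [← hf a]
      exact (limitPoint_comp_comap (f i) _ p).symm
  choose F hF using hex
  exact existsUnique_frameHom_of_limitPoint_lift (characterProj c)
    (character_ext_of_isLimit hc) f hF

theorem preservesLimits_gelfandSpec : PreservesLimitsOfSize.{w', w} gelfandSpec.{u} where
  preservesLimitsOfShape {J} _ := ⟨fun {K} => ⟨fun {c} hc => by
    have ex (s : Cone (K ⋙ gelfandSpec)) := existsUnique_frameHom hc (L := s.pt.unop)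
      (fun j => (s.π.app j).unop.hom) fun {i j} a =>
        congrArg (fun g => g.unop.hom) (s.w a)
    refine ⟨{ lift := fun s => (Frm.ofHom (ex s).choose).op, fac := ?_, uniq := ?_ }⟩
    · intro s j
      exact congrArg (fun g => (Frm.ofHom g).op) ((ex s).choose_spec.1 j)
    · intro s m hm
      have := (ex s).choose_spec.2 m.unop.hom fun j => congrArg (fun g => g.unop.hom) (hm j)
      exact congrArg (fun g => (Frm.ofHom g).op) this⟩⟩

end Limit

end CommCStarAlg

/-! ### Complemented elements and the frame of ideals -/

namespace StoneSpectrum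

section

variable {B L : Type u} [BooleanAlgebra B] [Order.Frame L]

lemma principal_sup (a b : B) : Order.Ideal.principal (a ⊔ b) =
    Order.Ideal.principal a ⊔ Order.Ideal.principal b := by
  refine eq_of_forall_ge_iff fun I => ?_
  simp only [Order.Ideal.principal_le_iff, sup_le_iff, Order.Ideal.sup_mem_iff]

lemma principal_inf (a b : B) : Order.Ideal.principal (a ⊓ b) =
    Order.Ideal.principal a ⊓ Order.Ideal.principal b :=
  Order.Ideal.ext (Set.ext fun _ => le_inf_iff)

lemma isComplemented_map_principal (f : FrameHom (Order.Ideal B) L) (b : B) :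
    IsComplemented (f (Order.Ideal.principal b)) := by
  refine ⟨f (Order.Ideal.principal bᶜ), ?_, ?_⟩
  · rw [disjoint_iff, ← map_inf, ← principal_inf, inf_compl_self]
    exact map_bot f
  · rw [codisjoint_iff, ← map_sup, ← principal_sup, sup_compl_eq_top, Order.Ideal.principal_top]
    exact map_top f

/-- A frame homomorphism on the ideals of a Boolean algebra restricts, along principal ideals, to a
homomorphism into the complemented elements of its codomain. -/
def restrictPrincipal (f : FrameHom (Order.Ideal B) L) :
    BoundedLatticeHom B (Complementeds L) where
  toFun b := ⟨f (Order.Ideal.principal b), isComplemented_map_principal f b⟩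
  map_sup' a b := Subtype.ext ((congrArg f (principal_sup a b)).trans (map_sup f _ _))
  map_inf' a b := Subtype.ext ((congrArg f (principal_inf a b)).trans (map_inf f _ _))
  map_top' := Subtype.ext ((congrArg f Order.Ideal.principal_top).trans (map_top f))
  map_bot' := Subtype.ext (map_bot f)

/-- The ideal of the elements that a homomorphism sends below a given element. -/
def idealBelow (h : BoundedLatticeHom B (Complementeds L)) (l : L) : Order.Ideal B where
  carrier := {b | (h b : L) ≤ l}
  lower' a b hba ha := le_trans (show h b ≤ h a from OrderHomClass.mono h hba) ha
  nonempty' := ⟨⊥, by rw [Set.mem_ofPred_eq, map_bot]; exact bot_le⟩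
  directed' a ha b hb := ⟨a ⊔ b, by
    rw [Set.mem_ofPred_eq, map_sup]; exact sup_le ha hb, le_sup_left, le_sup_right⟩

lemma gc_idealBelow (h : BoundedLatticeHom B (Complementeds L)) :
    GaloisConnection (fun I : Order.Ideal B => ⨆ b ∈ I, (h b : L)) (idealBelow h) :=
  fun _ _ => iSup₂_le_iff

/-- A Boolean homomorphism into the complemented elements of a frame extends to the ideals by
taking joins. -/
def extendIdeal (h : BoundedLatticeHom B (Complementeds L)) : FrameHom (Order.Ideal B) L where
  toFun I := ⨆ b ∈ I, (h b : L)
  map_inf' I J := by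
    apply le_antisymm
    · exact le_inf ((gc_idealBelow h).monotone_l inf_le_left)
        ((gc_idealBelow h).monotone_l inf_le_right)
    · simp only [iSup_inf_eq, inf_iSup_eq]
      refine iSup₂_le fun b hb => iSup₂_le fun a ha => ?_
      rw [← Complementeds.coe_inf, ← map_inf]
      exact le_iSup₂_of_le (a ⊓ b) ⟨I.lower inf_le_left ha, J.lower inf_le_right hb⟩ le_rfl
  map_top' := top_le_iff.1 (le_iSup₂_of_le ⊤ trivial (by rw [map_top]; exact le_rfl))
  map_sSup' S := by
    rw [(gc_idealBelow h).l_sSup, sSup_image]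

/-- Frame homomorphisms out of the frame of ideals of a Boolean algebra `B` correspond to
homomorphisms from `B` to the Boolean algebra of complemented elements. -/
def idealHomEquiv :
    FrameHom (Order.Ideal B) L ≃ BoundedLatticeHom B (Complementeds L) where
  toFun := restrictPrincipal
  invFun := extendIdeal
  left_inv f := by
    refine FrameHom.ext fun I => ?_
    have hI : I = ⨆ b ∈ I, Order.Ideal.principal b :=
      le_antisymm
        (fun b hb => (le_iSup₂ (f := fun b (_ : b ∈ I) => Order.Ideal.principal b) b hb) le_rfl)
        (iSup₂_le fun b hb => Order.Ideal.principal_le_iff.2 hb)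
    conv_rhs => rw [hI, map_iSup₂]
    rfl
  right_inv h := by
    refine BoundedLatticeHom.ext fun b => Subtype.ext ?_
    apply le_antisymm
    · exact iSup₂_le fun a ha => show h a ≤ h b from OrderHomClass.mono h ha
    · exact le_iSup₂_of_le b le_rfl le_rfl

end

/-- The Boolean algebra of complemented elements of a frame. -/
noncomputable def complementedsBoolAlg (L : Frm.{u}) : BoolAlg.{u} :=
  @BoolAlg.of (Complementeds L) (DistribLattice.booleanAlgebraOfComplemented _)

/-- The ideal functor is left adjoint to taking complemented elements. -/
instance isLeftAdjoint_idlFrm : idlFrm.{u}.IsLeftAdjoint :=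
  (Adjunction.adjunctionOfEquivRight
    (F := idlFrm.{u}) (G_obj := complementedsBoolAlg)
    (fun B L =>
      { toFun := fun f => ConcreteCategory.ofHom (C := BoolAlg) (restrictPrincipal f.hom)
        invFun := fun h => Frm.ofHom (extendIdeal h.hom)
        left_inv := fun f => Frm.hom_ext (idealHomEquiv.left_inv f.hom)
        right_inv := fun h => BoolAlg.hom_ext (idealHomEquiv.right_inv h.hom) })
    fun B' B L f g => by
      refine BoolAlg.ext fun b => Subtype.ext ?_
      refine congrArg g.hom (Order.Ideal.ext (Set.ext fun y => ?_))
      exact ⟨fun ⟨x, hx, hy⟩ => hy.trans (OrderHomClass.mono f.hom hx),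
        fun hy => ⟨b, le_rfl, hy⟩⟩).isLeftAdjoint

lemma preservesLimits_stoneIdl : PreservesLimitsOfSize.{w', w} stoneIdl.{u} :=
  (Adjunction.ofIsLeftAdjoint idlFrm.{u}).op.rightAdjoint_preservesLimits

end StoneSpectrum

theorem mainTheorem8 :
    PreservesLimitsOfSize.{w', w} CommCStarAlg.gelfandSpec.{u} ∧
      PreservesLimitsOfSize.{w', w} StoneSpectrum.stoneIdl.{u} :=
  ⟨CommCStarAlg.preservesLimits_gelfandSpec, StoneSpectrum.preservesLimits_stoneIdl⟩
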